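/- Let $k$ be a field, let $A$ be a finite dimensional associative unital $k$-algebra, and let $\operatorname{mod} A$ be the category of finitely generated left $A$-modules. A torsion pair in $\operatorname{mod} A$ is a pair $(\mathcal T,\mathcal F)$ of full, isomorphism-closed subcategories such that $\mathcal T\cap\mathcal F$ consists of zero modules, $\mathcal T$ is closed under factor modules, $\mathcal F$ is closed under submodules, and every $M$ in $\operatorname{mod} A$ has a unique submodule $t(M)$ with $t(M)\in\mathcal T$ and $M/t(M)\in\mathcal F$; then $\mathcal T$ is called a torsion class. Let $\operatorname{tors} A$ be the complete lattice of all torsion classes in $\operatorname{mod} A$, ordered by inclusion, with least element $0$ and greatest element $\operatorname{mod} A$. A brick is a module $B$ in $\operatorname{mod} A$ whose endomorphism ring is a division ring. For torsion classes $\mathcal U\subseteq\mathcal V$, the Hasse quiver $\operatorname{Hasse}[\mathcal U,\mathcal V]$ of the interval $[\mathcal U,\mathcal V]$ of $\operatorname{tors} A$ has one arrow for each cover relation $\mathcal U'\lessdot\mathcal V'$ in $[\mathcal U,\mathcal V]$, and the label of this arrow is the brick $B$, unique up to isomorphism, that lies in $\mathcal V'$ and satisfies $\operatorname{Hom}_A(U,B)=0$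 for all $U\in\mathcal U'$. For a torsion pair $(\mathcal T,\mathcal F)$ in $\operatorname{mod} A$, the following are equivalent: 1. $(\mathcal T,\mathcal F)$ is brick-splitting, that is, every brick in $\operatorname{mod} A$ lies in $\mathcal T$ or in $\mathcal F$. 2. Every brick in $\operatorname{mod} A$ is the label of an arrow of $\operatorname{Hasse}[0,\mathcal T]$ or of $\operatorname{Hasse}[\mathcal T,\operatorname{mod} A]$. 3. $\mathcal T$ is a left modular element of the lattice $\operatorname{tors} A$, that is, $(\mathcal Y\vee\mathcal T)\wedge\mathcal Z=\mathcal Y\vee(\mathcal T\wedge\mathcal Z)$ for all $\mathcal Y\subseteq\mathcal Z$ in $\operatorname{tors} A$. -/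

import Mathlib

open CategoryTheory

universe u w

namespace BrickSplitting

section Modules

variable {A : Type u} [Ring A]

/-- A torsion pair `(T, F)` in `mod A`, the category of finitely generated left `A`-modules.
The full subcategories `T` and `F` of `mod A` are given as isomorphism-closed properties of
`A`-modules that hold only for finitely generated modules. -/
structure IsTorsionPair (T F : ObjectProperty (ModuleCat.{u} A)) : Prop where
  finite_left : ∀ M, T M → Module.Finite A M
  finite_right : ∀ M, F M → Module.Finite A M
  iso_left : ∀ M N : ModuleCat.{u} A, (M ≃ₗ[A] N) → T M → T N
  iso_right : ∀ M N : ModuleCat.{u} A, (M ≃ₗ[A] N) → F M → F N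
  eq_zero : ∀ M, T M → F M → Subsingleton M
  factor : ∀ M : ModuleCat.{u} A, T M → ∀ N : Submodule A M, T (ModuleCat.of A (M ⧸ N))
  sub : ∀ M : ModuleCat.{u} A, F M → ∀ N : Submodule A M, F (ModuleCat.of A N)
  exists_torsion : ∀ M : ModuleCat.{u} A, Module.Finite A M →
    ∃! t : Submodule A M, T (ModuleCat.of A t) ∧ F (ModuleCat.of A (M ⧸ t))

/-- The right perpendicular subcategory `C^⊥` in `mod A`. -/
def rightPerp (C : ObjectProperty (ModuleCat.{u} A)) : ObjectProperty (ModuleCat.{u} A) :=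
  fun X => Module.Finite A X ∧ ∀ M : ModuleCat.{u} A, C M → ∀ f : M →ₗ[A] X, f = 0

/-- A brick: a finitely generated module whose endomorphism ring is a division ring. -/
def IsBrick (X : ModuleCat.{u} A) : Prop :=
  Module.Finite A X ∧ Nontrivial (Module.End A X) ∧ ∀ f : Module.End A X, f ≠ 0 → IsUnit f

/-- The pair `(T, F)` is brick-splitting: every brick belongs to `T` or to `F`. -/
def IsBrickSplitting (T F : ObjectProperty (ModuleCat.{u} A)) : Prop :=
  IsTorsionPair T F ∧ ∀ B, IsBrick B → T B ∨ F B

namespace IsTorsionPair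

variable {T F : ObjectProperty (ModuleCat.{u} A)}

lemma of_surjective (h : IsTorsionPair T F) {M N : ModuleCat.{u} A} (hM : T M)
    (f : M →ₗ[A] N) (hf : Function.Surjective f) : T N :=
  h.iso_left _ _ (f.quotKerEquivOfSurjective hf) (h.factor M hM _)

lemma of_injective (h : IsTorsionPair T F) {M N : ModuleCat.{u} A} (hN : F N)
    (f : M →ₗ[A] N) (hf : Function.Injective f) : F M :=
  h.iso_right _ _ (LinearEquiv.ofInjective f hf).symm (h.sub N hN _)

lemma hom_eq_zero (h : IsTorsionPair T F) {M N : ModuleCat.{u} A} (hM : T M) (hN : F N)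
    (f : M →ₗ[A] N) : f = 0 := by
  have h1 : T (ModuleCat.of A (LinearMap.range f)) :=
    h.of_surjective hM f.rangeRestrict f.surjective_rangeRestrict
  have h2 := h.eq_zero _ h1 (h.sub N hN _)
  rw [← LinearMap.range_eq_bot]
  exact (Submodule.subsingleton_iff_eq_bot).1 h2

lemma of_subsingleton (h : IsTorsionPair T F) {M : ModuleCat.{u} A} (hM : Subsingleton M) :
    T M := by
  obtain ⟨t, ht, -⟩ := h.exists_torsion M inferInstance
  exact h.of_surjective ht.1 t.subtype (fun x => ⟨0, Subsingleton.elim _ _⟩)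

/-- A torsion class is closed under extensions. -/
lemma of_ext (h : IsTorsionPair T F) {M : ModuleCat.{u} A} (hM : Module.Finite A M)
    (N : Submodule A M) (hN : T (ModuleCat.of A N)) (hQ : T (ModuleCat.of A (M ⧸ N))) : T M := by
  obtain ⟨t, ⟨ht, hf⟩, -⟩ := h.exists_torsion M hM
  have h0 : N ≤ t := by
    have := h.hom_eq_zero hN hf (t.mkQ.comp N.subtype)
    intro x hx
    have := LinearMap.congr_fun this ⟨x, hx⟩
    simpa using this
  have h1 : T (ModuleCat.of A (M ⧸ t)) :=
    h.of_surjective hQ (Submodule.factor h0) (Submodule.factor_surjective h0)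
  have h2 : Subsingleton (M ⧸ t) := h.eq_zero _ h1 hf
  have h3 : t = ⊤ := Submodule.Quotient.subsingleton_iff.1 h2
  refine h.of_surjective ht t.subtype (fun x => ⟨⟨x, h3 ▸ trivial⟩, rfl⟩)

end IsTorsionPair

/-- Over a left Noetherian ring, a factor-closed and extension-closed class of finitely generated
modules that contains the zero modules is the left half of a torsion pair. -/
lemma isTorsionPair_rightPerp [IsNoetherianRing A] (T : ObjectProperty (ModuleCat.{u} A))
    (hfin : ∀ M, T M → Module.Finite A M)
    (hzero : ∀ M : ModuleCat.{u} A, Subsingleton M → T M)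
    (hsurj : ∀ (M N : ModuleCat.{u} A) (f : M →ₗ[A] N), Function.Surjective f → T M → T N)
    (hext : ∀ M : ModuleCat.{u} A, Module.Finite A M → ∀ N : Submodule A M,
      T (ModuleCat.of A N) → T (ModuleCat.of A (M ⧸ N)) → T M) :
    IsTorsionPair T (rightPerp T) where
  finite_left := hfin
  finite_right M h := h.1
  iso_left M N e h := hsurj _ _ e.toLinearMap e.surjective h
  iso_right M N e h := by
    have := h.1
    refine ⟨Module.Finite.equiv e, fun C hC f => ?_⟩
    have h1 := h.2 C hC (e.symm.toLinearMap.comp f)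
    ext x
    have := LinearMap.congr_fun h1 x
    simpa using this
  eq_zero M h1 h2 := by
    have h3 := h2.2 M h1 LinearMap.id
    refine subsingleton_of_forall_eq 0 fun x => ?_
    simpa using LinearMap.congr_fun h3 x
  factor M h N := hsurj M _ N.mkQ N.mkQ_surjective h
  sub M h N := by
    have := h.1
    refine ⟨show Module.Finite A N from inferInstance, fun C hC f => ?_⟩
    have h1 := h.2 C hC (N.subtype.comp f)
    refine LinearMap.ext fun x => Subtype.ext ?_
    simpa using LinearMap.congr_fun h1 x
  exists_torsion M hM := by
    have key : ∀ t s : Submodule A M, T (ModuleCat.of A t) →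
        rightPerp T (ModuleCat.of A (M ⧸ s)) → t ≤ s := by
      intro t s ht hs x hx
      have := hs.2 _ ht (s.mkQ.comp t.subtype)
      simpa using LinearMap.congr_fun this ⟨x, hx⟩
    obtain ⟨t, ht, hmax⟩ := WellFounded.has_min (wellFounded_gt (α := Submodule A M))
      {t : Submodule A M | T (ModuleCat.of A t)}
      ⟨⊥, hzero _ (show Subsingleton (⊥ : Submodule A M) from inferInstance)⟩
    have hF : rightPerp T (ModuleCat.of A (M ⧸ t)) := by
      refine ⟨show Module.Finite A (M ⧸ t) from inferInstance, fun C hC f => ?_⟩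
      let f' : C →ₗ[A] (M ⧸ t) := f
      have hR : T (ModuleCat.of A (LinearMap.range f')) :=
        hsurj C _ f'.rangeRestrict f'.surjective_rangeRestrict hC
      let N : Submodule A M := (LinearMap.range f').comap t.mkQ
      have htN : t ≤ N := by
        intro x hx
        have : t.mkQ x = 0 := by simpa using hx
        change t.mkQ x ∈ LinearMap.range f'
        rw [this]
        exact zero_mem _
      let g : N →ₗ[A] LinearMap.range f' :=
        (t.mkQ.comp N.subtype).codRestrict _ (fun x => x.2)
      have hgs : Function.Surjective g := by
        rintro ⟨y, hy⟩
        obtain ⟨x, rfl⟩ := t.mkQ_surjective y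
        exact ⟨⟨x, hy⟩, rfl⟩
      let i : t →ₗ[A] LinearMap.ker g :=
        (Submodule.inclusion htN).codRestrict _ (fun x => by
          rw [LinearMap.mem_ker]
          exact Subtype.ext (by
            change t.mkQ (x : M) = 0
            simp))
      have his : Function.Surjective i := by
        rintro ⟨⟨x, hx⟩, hx'⟩
        have h1 : t.mkQ x = 0 := congrArg Subtype.val (LinearMap.mem_ker.1 hx')
        have h2 : x ∈ t := by simpa using h1
        exact ⟨⟨x, h2⟩, rfl⟩
      have hN : T (ModuleCat.of A N) := by
        refine hext (ModuleCat.of A N) (show Module.Finite A N from inferInstance)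
          (LinearMap.ker g) (hsurj _ _ i his ht) ?_
        exact hsurj (ModuleCat.of A (LinearMap.range f')) _
          (g.quotKerEquivOfSurjective hgs).symm.toLinearMap
          (g.quotKerEquivOfSurjective hgs).symm.surjective hR
      have hNt : N = t := by
        by_contra hne
        exact hmax N hN (lt_of_le_of_ne htN (Ne.symm hne))
      refine LinearMap.ext fun c => ?_
      obtain ⟨x, hx⟩ := t.mkQ_surjective (f' c)
      have hxN : x ∈ N := ⟨c, hx.symm⟩
      rw [hNt] at hxN
      have : t.mkQ x = 0 := by simpa using hxN
      change f' c = 0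
      rw [← hx, this]
    exact ⟨t, ⟨ht, hF⟩, fun s hs => le_antisymm (key s t hs.1 hF) (key t s ht hs.2)⟩

end Modules

section Tors

variable (k : Type w) (A : Type u) [Field k] [Ring A] [Algebra k A]

/-- The set `tors A` of torsion classes in `mod A`, for a `k`-algebra `A`. -/
def Tors (k : Type w) (A : Type u) [Field k] [Ring A] [Algebra k A] : Type (u + 1) :=
  {T : ObjectProperty (ModuleCat.{u} A) // ∃ F, IsTorsionPair T F}

/-- The torsion class of a torsion pair, as an element of `tors A`. -/
def IsTorsionPair.torsionClass (k : Type w) {A : Type u} [Field k] [Ring A] [Algebra k A]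
    {T F : ObjectProperty (ModuleCat.{u} A)} (h : IsTorsionPair T F) : Tors k A :=
  ⟨T, F, h⟩

/-- Torsion classes are ordered by inclusion. -/
instance : PartialOrder (Tors k A) :=
  inferInstanceAs (PartialOrder {T : ObjectProperty (ModuleCat.{u} A) // ∃ F, IsTorsionPair T F})

variable [FiniteDimensional k A]

/-- The meet of a set of torsion classes is their intersection (in `mod A`). -/
instance : InfSet (Tors k A) where
  sInf S := ⟨fun M => Module.Finite A M ∧ ∀ T ∈ S, T.1 M, by
    have : IsNoetherianRing A := isNoetherian_of_tower k inferInstance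
    refine ⟨_, isTorsionPair_rightPerp _ (fun M h => h.1) ?_ ?_ ?_⟩
    · intro M hM
      refine ⟨inferInstance, fun T _ => ?_⟩
      obtain ⟨F, hF⟩ := T.2
      exact hF.of_subsingleton hM
    · intro M N f hf hM
      have := hM.1
      refine ⟨Module.Finite.of_surjective f hf, fun T hT => ?_⟩
      obtain ⟨F, hF⟩ := T.2
      exact hF.of_surjective (hM.2 T hT) f hf
    · intro M hM N hN hQ
      refine ⟨hM, fun T hT => ?_⟩
      obtain ⟨F, hF⟩ := T.2
      exact hF.of_ext hM N (hN.2 T hT) (hQ.2 T hT)⟩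

/-- The complete lattice `tors A`; joins are the meets of the sets of upper bounds. -/
noncomputable instance : CompleteLattice (Tors k A) :=
  completeLatticeOfInf (Tors k A) (fun S => by
    refine ⟨fun T hT M hM => hM.2 T hT, fun T hT M hM => ⟨?_, fun U hU => hT hU M hM⟩⟩
    obtain ⟨F, hF⟩ := T.2
    exact hF.finite_left M hM)

variable {k A}

/-- The least element of `tors A` is the class of zero modules. -/
lemma Tors.bot_apply (M : ModuleCat.{u} A) : (⊥ : Tors k A).1 M ↔ Subsingleton M := by
  have : IsNoetherianRing A := isNoetherian_of_tower k inferInstance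
  constructor
  · intro h
    let Z : Tors k A := ⟨fun M => Subsingleton M, _, isTorsionPair_rightPerp _
      (fun M (h : Subsingleton M) => inferInstance) (fun M h => h)
      (fun M N f hf (h : Subsingleton M) => hf.subsingleton)
      (fun M _ N h1 h2 => by
        have e1 : N = ⊥ := Submodule.subsingleton_iff_eq_bot.1 h1
        have e2 : N = ⊤ := Submodule.Quotient.subsingleton_iff.1 h2
        exact (Submodule.subsingleton_iff A (M := M)).1 (subsingleton_of_bot_eq_top (e1 ▸ e2)))⟩
    exact (bot_le : (⊥ : Tors k A) ≤ Z) M h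
  · intro h
    obtain ⟨F, hF⟩ := (⊥ : Tors k A).2
    exact hF.of_subsingleton h

/-- The greatest element of `tors A` is `mod A`. -/
lemma Tors.top_apply (M : ModuleCat.{u} A) : (⊤ : Tors k A).1 M ↔ Module.Finite A M := by
  constructor
  · intro h
    obtain ⟨F, hF⟩ := (⊤ : Tors k A).2
    exact hF.finite_left M h
  · intro h
    exact (le_top : sInf (∅ : Set (Tors k A)) ≤ ⊤) M ⟨h, fun T hT => hT.elim⟩

/-- The set `brick [U, T]` of bricks in `T ∩ U^⊥`. -/
def brickInterval (U T : Tors k A) : Set (ModuleCat.{u} A) :=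
  {X | IsBrick X ∧ T.1 X ∧ rightPerp U.1 X}

/-- `B` is the label of the arrow between `U ≤ T` of the Hasse quiver: up to isomorphism, it is
the unique element of `brick [U, T]`. -/
def IsLabel (B : ModuleCat.{u} A) (U T : Tors k A) : Prop :=
  B ∈ brickInterval U T ∧ ∀ X ∈ brickInterval U T, Nonempty (X ≃ₗ[A] B)

/-- `B` labels an arrow of the Hasse quiver of the interval `[U, T]` of `tors A`. -/
def LabelsArrowOfInterval (B : ModuleCat.{u} A) (U T : Tors k A) : Prop :=
  ∃ X Y : Set.Icc U T, X ⋖ Y ∧ IsLabel B X.1 Y.1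

end Tors

/-- Left modular elements of a lattice. -/
def IsLeftModular {L : Type*} [Lattice L] (x : L) : Prop :=
  ∀ y z : L, y ≤ z → (y ⊔ x) ⊓ z = y ⊔ (x ⊓ z)

end BrickSplitting

/-! For a brick B, let G be the torsion class generated by B and P the class of modules without
nonzero maps to B. Since nonzero endomorphisms of B are invertible, every torsion class strictly
inside G lies in P, and every one strictly above P contains B. So G ⊓ P ⋖ G and P ⋖ P ⊔ G, and both
arrows have label B. The first lies below T when B is in T; the second lies above T when B is in F,
as then T ≤ P. Conversely, a label below T lies in T and one above T lies in T^⊥ = F.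

Modularity uses that a failed inclusion of torsion classes is witnessed by a brick
(`exists_brick_of_not_le`); such a brick, being in T or F, contradicts the failure. If instead a
brick B is in neither T nor F, the modular law fails for Y = G ⊓ P and Z = G: only the left side
contains B. -/

namespace BrickSplitting

/-! ### Torsion-free classes and endomorphisms of bricks -/

section Bricks

variable {A : Type u} [Ring A]

/-- A module belongs to the torsion-free class iff it receives no nonzero map from the torsion
class. -/
lemma IsTorsionPair.right_iff {T F : ObjectProperty (ModuleCat.{u} A)} (h : IsTorsionPair T F)
    (M : ModuleCat.{u} A) : F M ↔ rightPerp T M := by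
  refine ⟨fun hM => ⟨h.finite_right M hM, fun N hN f => h.hom_eq_zero hN hM f⟩, fun hM => ?_⟩
  obtain ⟨t, ⟨ht, hf⟩, -⟩ := h.exists_torsion M hM.1
  have h0 : t = ⊥ := by
    have := hM.2 _ ht t.subtype
    rw [← t.range_subtype]
    exact LinearMap.range_eq_bot.2 this
  exact h.of_injective hf t.mkQ (LinearMap.ker_eq_bot.1 (by rw [t.ker_mkQ, h0]))

lemma rightPerp_of_injective [IsNoetherianRing A] {C : ObjectProperty (ModuleCat.{u} A)}
    {M N : ModuleCat.{u} A} (hN : rightPerp C N) (i : M →ₗ[A] N) (hi : Function.Injective i) :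
    rightPerp C M := by
  have := hN.1
  refine ⟨Module.Finite.of_injective i hi, fun X hX f => LinearMap.ext fun x => hi ?_⟩
  simpa using LinearMap.congr_fun (hN.2 X hX (i.comp f)) x

lemma IsBrick.nontrivial {B : ModuleCat.{u} A} (hB : IsBrick B) : Nontrivial B := by
  by_contra hB'
  have : Subsingleton B := not_nontrivial_iff_subsingleton.1 hB'
  obtain ⟨f, g, hfg⟩ := hB.2.1
  exact hfg (LinearMap.ext fun x => Subsingleton.elim _ _)

lemma IsBrick.bijective {B : ModuleCat.{u} A} (hB : IsBrick B) (f : B →ₗ[A] B) (hf : f ≠ 0) :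
    Function.Bijective f :=
  (Module.End.isUnit_iff _).1 (hB.2.2 f hf)

/-- A brick has no nonzero maps from its proper factor modules. -/
lemma IsBrick.hom_quotient_eq_zero {B : ModuleCat.{u} A} (hB : IsBrick B) {N : Submodule A B}
    (hN : N ≠ ⊥) (f : (B ⧸ N) →ₗ[A] B) : f = 0 := by
  by_contra hf
  have h0 : f.comp N.mkQ ≠ 0 := fun h0 => hf <| by
    refine LinearMap.ext fun x => ?_
    obtain ⟨y, rfl⟩ := N.mkQ_surjective x
    exact LinearMap.congr_fun h0 y
  have h1 := (hB.bijective _ h0).1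
  refine hN ((Submodule.eq_bot_iff _).2 fun x hx => h1 ?_)
  have : N.mkQ x = 0 := by simpa using hx
  simp [this]

end Bricks

/-! ### Torsion classes determined by a single module -/

section Tors

variable {k : Type w} {A : Type u} [Field k] [Ring A] [Algebra k A]

namespace Tors

lemma finite (U : Tors k A) {M : ModuleCat.{u} A} (hM : U.1 M) : Module.Finite A M := by
  obtain ⟨F, hF⟩ := U.2
  exact hF.finite_left M hM

lemma of_surjective (U : Tors k A) {M N : ModuleCat.{u} A} (hM : U.1 M) (f : M →ₗ[A] N)
    (hf : Function.Surjective f) : U.1 N := by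
  obtain ⟨F, hF⟩ := U.2
  exact hF.of_surjective hM f hf

lemma range (U : Tors k A) {M N : ModuleCat.{u} A} (hM : U.1 M) (f : M →ₗ[A] N) :
    U.1 (ModuleCat.of A (LinearMap.range f)) :=
  U.of_surjective hM f.rangeRestrict f.surjective_rangeRestrict

lemma of_ext (U : Tors k A) {M : ModuleCat.{u} A} (hM : Module.Finite A M) (N : Submodule A M)
    (hN : U.1 (ModuleCat.of A N)) (hQ : U.1 (ModuleCat.of A (M ⧸ N))) : U.1 M := by
  obtain ⟨F, hF⟩ := U.2
  exact hF.of_ext hM N hN hQ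

lemma subsingleton_of_rightPerp (U : Tors k A) {M : ModuleCat.{u} A} (hM : U.1 M)
    (hM' : rightPerp U.1 M) : Subsingleton M := by
  have h := hM'.2 M hM LinearMap.id
  exact subsingleton_of_forall_eq 0 fun x => by simpa using LinearMap.congr_fun h x

lemma rightPerp_anti {U V : Tors k A} (h : U ≤ V) {X : ModuleCat.{u} A}
    (hX : rightPerp V.1 X) : rightPerp U.1 X :=
  ⟨hX.1, fun M hM => hX.2 M (h M hM)⟩

variable [FiniteDimensional k A]

/-- The torsion class of all finitely generated modules without nonzero maps to `X`. -/
def leftPerp (k : Type w) {A : Type u} [Field k] [Ring A] [Algebra k A] [FiniteDimensional k A]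
    (X : ModuleCat.{u} A) : Tors k A :=
  ⟨fun M => Module.Finite A M ∧ ∀ f : M →ₗ[A] X, f = 0, by
    have : IsNoetherianRing A := isNoetherian_of_tower k inferInstance
    refine ⟨_, isTorsionPair_rightPerp _ (fun M h => h.1) ?_ ?_ ?_⟩
    · exact fun M hM => ⟨inferInstance, fun f => LinearMap.ext fun x => by
        rw [Subsingleton.elim x 0, map_zero, map_zero]⟩
    · intro M N g hg hM
      have := hM.1
      refine ⟨Module.Finite.of_surjective g hg, fun f => LinearMap.ext fun x => ?_⟩
      obtain ⟨y, rfl⟩ := hg x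
      exact LinearMap.congr_fun (hM.2 (f.comp g)) y
    · intro M hM N hN hQ
      refine ⟨hM, fun f => LinearMap.ext fun x => ?_⟩
      have hle : N ≤ LinearMap.ker f := fun y hy =>
        LinearMap.congr_fun (hN.2 (f.comp N.subtype)) ⟨y, hy⟩
      exact LinearMap.congr_fun (hQ.2 (N.liftQ f hle)) (N.mkQ x)⟩

/-- Joins are only known as least upper bounds; this turns Hom-vanishing into an upper bound, so
that it passes to joins. -/
lemma le_leftPerp_iff (U : Tors k A) {X : ModuleCat.{u} A} (hX : Module.Finite A X) :
    U ≤ leftPerp k X ↔ rightPerp U.1 X :=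
  ⟨fun h => ⟨hX, fun M hM => (h M hM).2⟩, fun h M hM => ⟨U.finite hM, h.2 M hM⟩⟩

/-- The smallest torsion class containing `X`. -/
noncomputable def generated (k : Type w) {A : Type u} [Field k] [Ring A] [Algebra k A]
    [FiniteDimensional k A] (X : ModuleCat.{u} A) : Tors k A :=
  sInf {U | U.1 X}

lemma mem_generated {X : ModuleCat.{u} A} (hX : Module.Finite A X) : (generated k X).1 X :=
  ⟨hX, fun _ hU => hU⟩

lemma generated_le_iff {X : ModuleCat.{u} A} (hX : Module.Finite A X) (U : Tors k A) :
    generated k X ≤ U ↔ U.1 X :=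
  ⟨fun h => h X (mem_generated hX), fun h => sInf_le h⟩

lemma inf_apply (U V : Tors k A) (M : ModuleCat.{u} A) : (U ⊓ V).1 M ↔ U.1 M ∧ V.1 M := by
  refine ⟨fun h => ⟨(inf_le_left : U ⊓ V ≤ U) M h, (inf_le_right : U ⊓ V ≤ V) M h⟩, fun h => ?_⟩
  have hM := U.finite h.1
  rw [← generated_le_iff hM, le_inf_iff, generated_le_iff hM, generated_le_iff hM]
  exact h

lemma rightPerp_sup {U V : Tors k A} {X : ModuleCat.{u} A} (hU : rightPerp U.1 X)
    (hV : rightPerp V.1 X) : rightPerp (U ⊔ V).1 X :=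
  (le_leftPerp_iff _ hU.1).1
    (sup_le ((le_leftPerp_iff _ hU.1).2 hU) ((le_leftPerp_iff _ hV.1).2 hV))

/-- If `X` has no nonzero map from `B`, it has none from the torsion class generated by `B`. -/
lemma rightPerp_generated {B X : ModuleCat.{u} A} (hB : Module.Finite A B)
    (hX : Module.Finite A X) (h : ∀ f : B →ₗ[A] X, f = 0) : rightPerp (generated k B).1 X := by
  rw [← le_leftPerp_iff _ hX, generated_le_iff hB]
  exact ⟨hB, h⟩

lemma exists_hom_ne_zero_of_mem_generated {B X : ModuleCat.{u} A} (hB : Module.Finite A B)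
    (hX : (generated k B).1 X) [Nontrivial X] : ∃ f : B →ₗ[A] X, f ≠ 0 := by
  by_contra! h
  exact not_subsingleton X
    (subsingleton_of_rightPerp _ hX (rightPerp_generated hB (finite _ hX) h))

/-- Two torsion classes `U`, `V` with `V` not contained in `U` are distinguished by a brick in
`V` that is torsion-free with respect to `U`. -/
lemma exists_brick_of_not_le {U V : Tors k A} (h : ¬ V ≤ U) : (brickInterval U V).Nonempty := by
  have hNoeth : IsNoetherianRing A := isNoetherian_of_tower k inferInstance
  have hArt : IsArtinianRing A := isArtinian_of_tower k inferInstance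
  obtain ⟨M, hMV, hMU⟩ : ∃ M, V.1 M ∧ ¬ U.1 M := by
    by_contra! h'
    exact h h'
  have hMfin := V.finite hMV
  obtain ⟨F, hF⟩ := U.2
  obtain ⟨t, ⟨ht, htF⟩, -⟩ := hF.exists_torsion M hMfin
  have hQV : V.1 (ModuleCat.of A (M ⧸ t)) := V.of_surjective hMV t.mkQ t.mkQ_surjective
  have hQU : rightPerp U.1 (ModuleCat.of A (M ⧸ t)) := (hF.right_iff _).1 htF
  have hQne : (⊤ : Submodule A (M ⧸ t)) ≠ ⊥ := fun hbot => hMU <| by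
    have hs : Subsingleton (M ⧸ t) :=
      (Submodule.subsingleton_iff A).1 (subsingleton_of_bot_eq_top hbot.symm)
    have htop : t = ⊤ := Submodule.Quotient.subsingleton_iff.1 hs
    exact U.of_surjective ht t.subtype fun x => ⟨⟨x, htop ▸ trivial⟩, rfl⟩
  -- A minimal nonzero submodule in V is a brick: the image of a nonzero endomorphism is again in V,
  -- hence is all of N, and a surjective endomorphism of a Noetherian module is injective.
  obtain ⟨N, ⟨hNne, hNV⟩, hmin⟩ := WellFounded.has_min (wellFounded_lt (α := Submodule A (M ⧸ t)))
    {N | N ≠ ⊥ ∧ V.1 (ModuleCat.of A N)}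
    ⟨⊤, hQne, V.of_surjective hQV (Submodule.topEquiv (R := A) (M := M ⧸ t)).symm.toLinearMap
      (Submodule.topEquiv (R := A) (M := M ⧸ t)).symm.surjective⟩
  refine ⟨ModuleCat.of A N, ⟨V.finite hNV, ?_, ?_⟩, hNV,
    rightPerp_of_injective hQU N.subtype N.subtype_injective⟩
  · have : Nontrivial N := (Submodule.nontrivial_iff_ne_bot).2 hNne
    exact inferInstanceAs (Nontrivial (Module.End A N))
  · intro f hf
    let g : N →ₗ[A] (M ⧸ t) := N.subtype.comp f
    have hgN : LinearMap.range g ≤ N := by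
      rintro _ ⟨x, rfl⟩
      exact (f x).2
    have hgV : V.1 (ModuleCat.of A (LinearMap.range g)) :=
      V.range (M := ModuleCat.of A N) (N := ModuleCat.of A (M ⧸ t)) hNV g
    have hgne : LinearMap.range g ≠ ⊥ := fun h0 => hf <| LinearMap.ext fun x => Subtype.ext
      (LinearMap.congr_fun (LinearMap.range_eq_bot.1 h0) x)
    have hgeq : LinearMap.range g = N := by
      by_contra hne
      exact hmin _ ⟨hgne, hgV⟩ (lt_of_le_of_ne hgN hne)
    let f' : N →ₗ[A] N := f
    have hsurj : Function.Surjective f' := by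
      rintro ⟨y, hy⟩
      rw [← hgeq] at hy
      obtain ⟨x, hx⟩ := hy
      exact ⟨x, Subtype.ext hx⟩
    exact (Module.End.isUnit_iff _).2
      ⟨IsNoetherian.injective_of_surjective_endomorphism f' hsurj, hsurj⟩

/-- A nonzero map to a brick `B` from a module in the torsion class generated by `B` is
surjective. -/
lemma surjective_of_mem_generated {B M : ModuleCat.{u} A} (hB : IsBrick B)
    (hM : (generated k B).1 M) (f : M →ₗ[A] B) (hf : f ≠ 0) : Function.Surjective f := by
  have : Nontrivial (LinearMap.range f) :=
    Submodule.nontrivial_iff_ne_bot.2 fun h => hf (LinearMap.range_eq_bot.1 h)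
  -- The image of f receives a nonzero map from B. Followed by the inclusion, it is a nonzero
  -- endomorphism of B, so the image is all of B.
  obtain ⟨g, hg⟩ := exists_hom_ne_zero_of_mem_generated (k := k)
    (X := ModuleCat.of A (LinearMap.range f)) hB.1 (range _ hM f)
  let g' : B →ₗ[A] LinearMap.range f := g
  have h1 : (LinearMap.range f).subtype.comp g' ≠ 0 := fun h0 => hg <|
    LinearMap.ext fun x => Subtype.ext (LinearMap.congr_fun h0 x)
  intro y
  obtain ⟨x, rfl⟩ := (hB.bijective _ h1).2 y
  exact (g' x).2

/-- The torsion class generated by a brick `B` has a greatest proper torsion subclass. -/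
lemma le_leftPerp_of_lt_generated {B : ModuleCat.{u} A} (hB : IsBrick B) {U : Tors k A}
    (hU : U < generated k B) : U ≤ leftPerp k B := by
  intro M hM
  refine ⟨U.finite hM, fun f => ?_⟩
  by_contra hf
  exact hU.not_ge ((generated_le_iff hB.1 U).2
    (U.of_surjective hM f (surjective_of_mem_generated hB (hU.le M hM) f hf)))

lemma not_mem_leftPerp_self {B : ModuleCat.{u} A} (hB : IsBrick B) : ¬ (leftPerp k B).1 B :=
  fun h => by
    have := hB.nontrivial
    exact not_subsingleton B
      (subsingleton_of_rightPerp _ h ((le_leftPerp_iff _ hB.1).1 le_rfl))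

lemma rightPerp_leftPerp {B : ModuleCat.{u} A} (hB : IsBrick B) :
    rightPerp (leftPerp k B).1 B :=
  (le_leftPerp_iff _ hB.1).1 le_rfl

/-- A torsion class strictly above the left perpendicular of a brick contains the brick. -/
lemma mem_of_leftPerp_lt {B : ModuleCat.{u} A} (hB : IsBrick B) {U : Tors k A}
    (hU : leftPerp k B < U) : U.1 B := by
  obtain ⟨M, hM, f, hf⟩ : ∃ M, U.1 M ∧ ∃ f : M →ₗ[A] B, f ≠ 0 := by
    by_contra! h
    exact hU.not_ge fun M hM => ⟨U.finite hM, h M hM⟩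
  have := hB.1
  -- B is an extension of its proper quotient B / im f, which has no nonzero map to B, by im f.
  refine U.of_ext hB.1 (LinearMap.range f) (U.range hM f) (hU.le _
    ⟨show Module.Finite A (B ⧸ LinearMap.range f) from inferInstance, fun g => ?_⟩)
  exact hB.hom_quotient_eq_zero (fun h => hf (LinearMap.range_eq_bot.1 h)) g

/-! ### The two arrows labelled by a brick -/

lemma inf_leftPerp_covBy_generated {B : ModuleCat.{u} A} (hB : IsBrick B) :
    generated k B ⊓ leftPerp k B ⋖ generated k B := by
  refine ⟨lt_of_le_of_ne inf_le_left fun h => not_mem_leftPerp_self (k := k) hB ?_, fun U h1 h2 =>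
    h1.not_ge (le_inf h2.le (le_leftPerp_of_lt_generated hB h2))⟩
  exact (inf_eq_left.1 h) B (mem_generated hB.1)

lemma leftPerp_covBy_sup_generated {B : ModuleCat.{u} A} (hB : IsBrick B) :
    leftPerp k B ⋖ leftPerp k B ⊔ generated k B := by
  refine ⟨lt_of_le_of_ne le_sup_left fun h => not_mem_leftPerp_self (k := k) hB ?_, fun U h1 h2 =>
    h2.not_ge (sup_le h1.le ((generated_le_iff hB.1 U).2 (mem_of_leftPerp_lt hB h1)))⟩
  exact (left_eq_sup.1 h) B (mem_generated hB.1)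

lemma isLabel_inf_leftPerp_generated {B : ModuleCat.{u} A} (hB : IsBrick B) :
    IsLabel B (generated k B ⊓ leftPerp k B) (generated k B) := by
  refine ⟨⟨hB, mem_generated hB.1, rightPerp_anti inf_le_right (rightPerp_leftPerp hB)⟩, ?_⟩
  rintro X ⟨hX, hXB, hXP⟩
  have hXnt := hX.nontrivial
  obtain ⟨f, hf⟩ : ∃ f : X →ₗ[A] B, f ≠ 0 := by
    by_contra! h
    exact not_subsingleton X (subsingleton_of_rightPerp _
      ((inf_apply (generated k B) (leftPerp k B) X).2 ⟨hXB, hX.1, h⟩) hXP)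
  have hsurj := surjective_of_mem_generated hB hXB f hf
  obtain ⟨g, hg⟩ := exists_hom_ne_zero_of_mem_generated hB.1 hXB
  -- As f is onto, g ∘ f is a nonzero endomorphism of the brick X, so f is also injective.
  have hgf : g.comp f ≠ 0 := fun h => hg <| LinearMap.ext fun x => by
    obtain ⟨y, rfl⟩ := hsurj x
    exact LinearMap.congr_fun h y
  have hinj : Function.Injective f :=
    Function.Injective.of_comp (f := g) (hX.bijective _ hgf).1
  exact ⟨LinearEquiv.ofBijective f ⟨hinj, hsurj⟩⟩

lemma isLabel_leftPerp_sup_generated {B : ModuleCat.{u} A} (hB : IsBrick B) :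
    IsLabel B (leftPerp k B) (leftPerp k B ⊔ generated k B) := by
  refine ⟨⟨hB, (le_sup_right : generated k B ≤ leftPerp k B ⊔ generated k B) B
    (mem_generated hB.1), rightPerp_leftPerp hB⟩, ?_⟩
  rintro X ⟨hX, hXB, hXP⟩
  have hXnt := hX.nontrivial
  have hBfin := hB.1
  obtain ⟨f, hf⟩ : ∃ f : X →ₗ[A] B, f ≠ 0 := by
    by_contra! h
    exact not_subsingleton X (subsingleton_of_rightPerp (leftPerp k B) ⟨hX.1, h⟩ hXP)
  obtain ⟨g, hg⟩ : ∃ g : B →ₗ[A] X, g ≠ 0 := by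
    by_contra! h
    exact not_subsingleton X (subsingleton_of_rightPerp _ hXB
      (rightPerp_sup hXP (rightPerp_generated hB.1 hX.1 h)))
  -- Otherwise g factors through B / im f, which lies in `leftPerp k B` and so has no nonzero map to
  -- X.
  have hgf : g.comp f ≠ 0 := fun h => hg <| by
    have hle : LinearMap.range f ≤ LinearMap.ker g := by
      rintro _ ⟨x, rfl⟩
      exact LinearMap.congr_fun h x
    have h0 := hXP.2 (ModuleCat.of A (B ⧸ LinearMap.range f))
      ⟨show Module.Finite A (B ⧸ LinearMap.range f) from inferInstance,
        fun q => hB.hom_quotient_eq_zero (fun h => hf (LinearMap.range_eq_bot.1 h)) q⟩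
      ((LinearMap.range f).liftQ g hle)
    exact LinearMap.ext fun x => LinearMap.congr_fun h0 ((LinearMap.range f).mkQ x)
  have hgfb := hX.bijective _ hgf
  have hgs : Function.Surjective g := Function.Surjective.of_comp (g := f) hgfb.2
  have hfg : f.comp g ≠ 0 := fun h => hf <| LinearMap.ext fun x => by
    obtain ⟨y, rfl⟩ := hgs x
    exact LinearMap.congr_fun h y
  exact ⟨LinearEquiv.ofBijective f ⟨Function.Injective.of_comp (f := g) hgfb.1,
    Function.Surjective.of_comp (g := g) (hB.bijective _ hfg).2⟩⟩

end Tors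

lemma LabelsArrowOfInterval.of_covBy [FiniteDimensional k A] {B : ModuleCat.{u} A}
    {U T X Y : Tors k A} (hUX : U ≤ X) (hYT : Y ≤ T) (hXY : X ⋖ Y) (hB : IsLabel B X Y) :
    LabelsArrowOfInterval B U T :=
  ⟨⟨X, hUX, hXY.le.trans hYT⟩, ⟨Y, hUX.trans hXY.le, hYT⟩,
    ⟨hXY.lt, fun Z h1 h2 => hXY.2 (c := Z.1) h1 h2⟩, hB⟩

/-! ### The equivalences -/

variable [FiniteDimensional k A] {T F : ObjectProperty (ModuleCat.{u} A)}

lemma IsBrickSplitting.labelsArrow (h : IsTorsionPair T F) (hs : IsBrickSplitting T F)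
    {B : ModuleCat.{u} A} (hB : IsBrick B) :
    LabelsArrowOfInterval B ⊥ (h.torsionClass k) ∨
      LabelsArrowOfInterval B (h.torsionClass k) ⊤ := by
  rcases hs.2 B hB with hT | hF
  · exact .inl (.of_covBy bot_le ((Tors.generated_le_iff hB.1 (h.torsionClass k)).2 hT)
      (Tors.inf_leftPerp_covBy_generated hB) (Tors.isLabel_inf_leftPerp_generated hB))
  · exact .inr (.of_covBy
      ((Tors.le_leftPerp_iff (h.torsionClass k) hB.1).2 ((h.right_iff B).1 hF)) le_top
      (Tors.leftPerp_covBy_sup_generated hB) (Tors.isLabel_leftPerp_sup_generated hB))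

lemma isBrickSplitting_of_labelsArrow (h : IsTorsionPair T F)
    (hl : ∀ B : ModuleCat.{u} A, IsBrick B → LabelsArrowOfInterval B ⊥ (h.torsionClass k) ∨
      LabelsArrowOfInterval B (h.torsionClass k) ⊤) : IsBrickSplitting T F := by
  refine ⟨h, fun B hB => ?_⟩
  rcases hl B hB with ⟨X, Y, -, hBl⟩ | ⟨X, Y, -, hBl⟩
  · exact .inl (Y.2.2 B hBl.1.2.1)
  · exact .inr ((h.right_iff B).2 (Tors.rightPerp_anti X.2.1 hBl.1.2.2))

lemma IsBrickSplitting.isLeftModular (h : IsTorsionPair T F) (hs : IsBrickSplitting T F) :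
    IsLeftModular (h.torsionClass k) := by
  intro Y Z hYZ
  refine le_antisymm ?_
    (sup_le (le_inf le_sup_left hYZ) (le_inf (inf_le_left.trans le_sup_right) inf_le_right))
  by_contra hle
  obtain ⟨B, hB, hBV, hBU⟩ := Tors.exists_brick_of_not_le hle
  have hBnt := hB.nontrivial
  obtain ⟨hBV₁, hBZ⟩ := (Tors.inf_apply _ _ _).1 hBV
  -- B is torsion-free for the right side and lies in Y ⊔ T and Z. If B is in T, it is in T ⊓ Z,
  -- below the right side; if in F, it is torsion-free for Y ⊔ T. Either way B = 0.
  rcases hs.2 B hB with hT | hF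
  · exact not_subsingleton B (Tors.subsingleton_of_rightPerp (h.torsionClass k ⊓ Z)
      ((Tors.inf_apply _ _ _).2 ⟨hT, hBZ⟩) (Tors.rightPerp_anti le_sup_right hBU))
  · exact not_subsingleton B (Tors.subsingleton_of_rightPerp _ hBV₁
      (Tors.rightPerp_sup (Tors.rightPerp_anti le_sup_left hBU) ((h.right_iff B).1 hF)))

lemma isBrickSplitting_of_isLeftModular (h : IsTorsionPair T F)
    (hm : IsLeftModular (h.torsionClass k)) : IsBrickSplitting T F := by
  refine ⟨h, fun B hB => ?_⟩
  by_contra! hTF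
  have hBfin := hB.1
  set G := Tors.generated k B
  set Y := G ⊓ Tors.leftPerp k B
  obtain ⟨t, ⟨ht, htF⟩, -⟩ := h.exists_torsion B hB.1
  have htne : t ≠ ⊥ := fun h0 => hTF.2 <|
    h.of_injective htF t.mkQ (LinearMap.ker_eq_bot.1 (by rw [t.ker_mkQ, h0]))
  have hBG : G.1 B := Tors.mem_generated hB.1
  -- B is not in F, so t ≠ 0 and B / t has no nonzero map to B.
  have hQ : Y.1 (ModuleCat.of A (B ⧸ t)) := (Tors.inf_apply _ _ _).2
    ⟨G.of_surjective hBG t.mkQ t.mkQ_surjective,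
      show Module.Finite A (B ⧸ t) from inferInstance,
      fun f => hB.hom_quotient_eq_zero htne f⟩
  have hBsup : (Y ⊔ h.torsionClass k).1 B := Tors.of_ext _ hB.1 t
    ((le_sup_right : h.torsionClass k ≤ Y ⊔ h.torsionClass k) _ ht)
    ((le_sup_left : Y ≤ Y ⊔ h.torsionClass k) _ hQ)
  have hlt : h.torsionClass k ⊓ G < G := lt_of_le_of_ne inf_le_right fun he =>
    hTF.1 ((inf_eq_right.1 he) B hBG)
  -- By modularity this is the join of Y and T ⊓ G, which is proper in G because B is not in T.
  have hle : (Y ⊔ h.torsionClass k) ⊓ G ≤ Tors.leftPerp k B := by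
    rw [hm Y G inf_le_left]
    exact sup_le inf_le_right (Tors.le_leftPerp_of_lt_generated hB hlt)
  exact Tors.not_mem_leftPerp_self hB (hle B ((Tors.inf_apply _ _ _).2 ⟨hBsup, hBG⟩))

end Tors

end BrickSplitting

theorem theorem1p1 (k : Type w) (A : Type u) [Field k] [Ring A] [Algebra k A]
    [FiniteDimensional k A] (T F : ObjectProperty (ModuleCat.{u} A))
    (h : BrickSplitting.IsTorsionPair T F) :
    List.TFAE [
      BrickSplitting.IsBrickSplitting T F,
      ∀ B : ModuleCat.{u} A, BrickSplitting.IsBrick B →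
        BrickSplitting.LabelsArrowOfInterval B ⊥ (h.torsionClass k) ∨
        BrickSplitting.LabelsArrowOfInterval B (h.torsionClass k) ⊤,
      BrickSplitting.IsLeftModular (h.torsionClass k)] := by
  tfae_have 1 → 2 := fun hs B hB => BrickSplitting.IsBrickSplitting.labelsArrow h hs hB
  tfae_have 2 → 1 := BrickSplitting.isBrickSplitting_of_labelsArrow h
  tfae_have 1 → 3 := BrickSplitting.IsBrickSplitting.isLeftModular h
  tfae_have 3 → 1 := BrickSplitting.isBrickSplitting_of_isLeftModular h
  tfae_finish
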